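/- Consider the Brockett–Heisenberg system on $[0,1]$, $$\dot x=u,\qquad \dot y=v,\qquad \dot z=vx-uy,\qquad x(0)=y(0)=z(0)=0,$$ with output $z(1)$ (solutions are absolutely continuous functions satisfying the equations almost everywhere). Let $$\mathcal B_0=\{\sqrt2\sin(2\pi t),\ \sqrt2\cos(2\pi t),\ \sqrt2\sin(4\pi t),\ \sqrt2\cos(4\pi t),\dots\}\subset L^2[0,1],$$ and let $\mathcal L\subset L^2[0,1]$ be the space of functions represented by a Fourier series in the elements of $\mathcal B_0$ (no constant term) with square-summable real coefficients. Let $m,n\ge 1$ and let $H$ be a real $m\times n$ matrix with singular values $\sigma_1(H)\ge\sigma_2(H)\ge\cdots$. Controls $u_1,\dots,u_m$ and $v_1,\dots,v_n$ realize $H$ in a single round if, for all $i,j$, the output of the system under the input pair $(u_i,v_j)$ is $z(1)=H_{ij}$; their cost is $$\frac1m\sum_{i=1}^m\int_0^1u_i(t)^2\,dt+\frac1n\sum_{j=1}^n\int_0^1v_j(t)^2\,dt .$$ Then the infimum of the cost over all $u_1,\dots,u_m,v_1,\dots,v_n\in\mathcal L$ that realize $H$ in a single round is $$\frac{2\pi}{\sqrt{mn}}\sum_{k=1}^{\min(m,n)}\Big\lceil\frac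 k2\Big\rceil\,\sigma_k(H),$$ and it is attained, by controls $u_i,v_j$ that lie in the linear span of $\mathcal B_0$. -/

import Mathlib

open MeasureTheory Set

namespace BrockettHeisenberg

/-- Lebesgue measure on the control interval `[0, 1]`. -/
noncomputable abbrev unitMeasure : Measure ℝ := volume.restrict (Icc (0 : ℝ) 1)

/-- The real Hilbert space `L²[0, 1]`. -/
abbrev L2 : Type := Lp ℝ 2 unitMeasure

/-- `x, y, z` is the (Carathéodory) solution on `[0, 1]` of the Brockett-Heisenberg system
`x' = u, y' = v, z' = v x - u y`, `x(0) = y(0) = z(0) = 0`: the three functions are absolutely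
continuous and the differential equations hold almost everywhere. -/
structure IsTrajectory (u v x y z : ℝ → ℝ) : Prop where
  x_ac : AbsolutelyContinuousOnInterval x 0 1
  y_ac : AbsolutelyContinuousOnInterval y 0 1
  z_ac : AbsolutelyContinuousOnInterval z 0 1
  x_zero : x 0 = 0
  y_zero : y 0 = 0
  z_zero : z 0 = 0
  x_deriv : ∀ᵐ t ∂unitMeasure, HasDerivAt x (u t) t
  y_deriv : ∀ᵐ t ∂unitMeasure, HasDerivAt y (v t) t
  z_deriv : ∀ᵐ t ∂unitMeasure, HasDerivAt z (v t * x t - u t * y t) t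

/-- The trigonometric functions
`√2 sin(2πt), √2 cos(2πt), √2 sin(4πt), √2 cos(4πt), …`, numbered from `0`. -/
noncomputable def trigFun (j : ℕ) (t : ℝ) : ℝ :=
  if Even j then √2 * Real.sin (2 * Real.pi * ((j / 2 + 1 : ℕ) : ℝ) * t)
  else √2 * Real.cos (2 * Real.pi * ((j / 2 + 1 : ℕ) : ℝ) * t)

theorem memLp_trigFun (j : ℕ) : MemLp (trigFun j) 2 unitMeasure := by
  have hc : Continuous (trigFun j) := by
    unfold trigFun
    split_ifs <;> fun_prop
  refine MemLp.of_bound hc.aestronglyMeasurable (√2) (Filter.Eventually.of_forall fun t => ?_)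
  have h2 : (0 : ℝ) ≤ √2 := Real.sqrt_nonneg 2
  unfold trigFun
  split_ifs
  · rw [norm_mul, Real.norm_of_nonneg h2]
    exact mul_le_of_le_one_right h2 (Real.abs_sin_le_one _)
  · rw [norm_mul, Real.norm_of_nonneg h2]
    exact mul_le_of_le_one_right h2 (Real.abs_cos_le_one _)

/-- The trigonometric basis `B₀` as a family of elements of `L²[0, 1]`. -/
noncomputable def trigBasis (j : ℕ) : L2 := (memLp_trigFun j).toLp (trigFun j)

/-- The space of admissible controls: the elements of `L²[0, 1]` that are represented by a
Fourier series in the functions of `B₀` (no constant term) with square summable coefficients. -/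
def admissible : Set L2 :=
  {f | ∃ a : ℕ → ℝ, Summable (fun j => a j ^ 2) ∧ HasSum (fun j => a j • trigBasis j) f}

/-- The controls `u₁, …, uₘ` of Alice and `v₁, …, vₙ` of Bob realize the target `H` in a single
round: under the pair `(uᵢ, vⱼ)` the output at time `1` is `Hᵢⱼ`. -/
def Realizes {m n : ℕ} (U : Fin m → L2) (V : Fin n → L2) (H : Matrix (Fin m) (Fin n) ℝ) : Prop :=
  ∀ i j, ∃ x y z : ℝ → ℝ, IsTrajectory (U i) (V j) x y z ∧ z 1 = H i j

/-- The control cost: the average energy of Alice's controls plus that of Bob's controls. -/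
noncomputable def controlCost {m n : ℕ} (U : Fin m → L2) (V : Fin n → L2) : ℝ :=
  (1 / (m : ℝ)) * ∑ i, (∫ t in (0 : ℝ)..1, (U i t) ^ 2) +
    (1 / (n : ℝ)) * ∑ j, (∫ t in (0 : ℝ)..1, (V j t) ^ 2)

/-- The `k`-th largest singular value of `H`, numbered from `k = 1`. -/
noncomputable def sigma {m n : ℕ} (H : Matrix (Fin m) (Fin n) ℝ) (k : ℕ) : ℝ :=
  (Matrix.toEuclideanLin H).singularValues (k - 1)

/-- The costs of all single round protocols with admissible controls that realize `H`. -/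
def costSet {m n : ℕ} (H : Matrix (Fin m) (Fin n) ℝ) : Set ℝ :=
  {c | ∃ (U : Fin m → L2) (V : Fin n → L2),
    (∀ i, U i ∈ admissible) ∧ (∀ j, V j ∈ admissible) ∧ Realizes U V H ∧ c = controlCost U V}

end BrockettHeisenberg

/-!
For the normalized derivatives `ψ_l` of the trigonometric functions `φ_l` (that is, `conjFun` and
`trigFun`), of frequency `f_l`, integration by parts gives
`z(1) = ∑ l, (π f_l)⁻¹ ⟪ψ_l, u⟫ ⟪φ_l, v⟫`. Realizing `H` therefore means writing it as a sum
`H = ∑ l, (π f_l)⁻¹ a_l b_lᵀ` of rank one matrices, at the cost `∑ l, (‖a_l‖² / m + ‖b_l‖² / n)`,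
which is at least `2 / √(mn) * ∑ l, ‖a_l‖ ‖b_l‖` by the AM-GM inequality.

Deleting the first `N` terms of a sum of rank one matrices deletes no more than `N` singular values,
so the remaining `∑ ‖·‖ ‖·‖` bounds the sum of all but the `N` largest singular values. Since the
frequencies `1, 1, 2, 2, …` increase, Abel summation over these tails gives the lower bound. The
singular value decomposition, with the larger singular values at the lower frequencies, attains it.
-/

namespace BrockettHeisenberg

section SingularVectors

variable {𝕜 E F : Type*} [RCLike 𝕜]
  [NormedAddCommGroup E] [InnerProductSpace 𝕜 E] [FiniteDimensional 𝕜 E]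
  [NormedAddCommGroup F] [InnerProductSpace 𝕜 F] [FiniteDimensional 𝕜 F]
  (T : E →ₗ[𝕜] F)

/-- The right singular vectors of `T`, in the order of the singular values: an orthonormal basis of
eigenvectors of `T† T`. -/
noncomputable def rightSingularBasis : OrthonormalBasis (Fin (Module.finrank 𝕜 E)) 𝕜 E :=
  T.isSymmetric_adjoint_comp_self.eigenvectorBasis rfl

/-- The left singular vectors of `T`. Since `0⁻¹ = 0`, those that belong to the singular value `0`
are zero. -/
noncomputable def leftSingularVector (k : Fin (Module.finrank 𝕜 E)) : F :=
  (T.singularValues k : 𝕜)⁻¹ • T (rightSingularBasis T k)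

theorem inner_apply_rightSingularBasis (k : Fin (Module.finrank 𝕜 E)) (x : E) :
    inner 𝕜 (T (rightSingularBasis T k)) (T x) =
      (T.singularValues k : 𝕜) ^ 2 * inner 𝕜 (rightSingularBasis T k) x := by
  have h : T.adjoint (T (rightSingularBasis T k)) =
      (T.singularValues k : 𝕜) ^ 2 • rightSingularBasis T k := by
    rw [← RCLike.ofReal_pow, T.sq_singularValues_fin rfl]
    exact T.isSymmetric_adjoint_comp_self.apply_eigenvectorBasis rfl k
  rw [← LinearMap.adjoint_inner_left, h, inner_smul_left]
  simp

theorem apply_rightSingularBasis (k : Fin (Module.finrank 𝕜 E)) :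
    T (rightSingularBasis T k) = (T.singularValues k : 𝕜) • leftSingularVector T k := by
  by_cases h : T.singularValues k = 0
  · have h0 := inner_apply_rightSingularBasis T k (rightSingularBasis T k)
    rw [h, RCLike.ofReal_zero, zero_pow two_ne_zero, zero_mul, inner_self_eq_zero] at h0
    rw [h0, h, RCLike.ofReal_zero, zero_smul]
  · rw [leftSingularVector, smul_inv_smul₀ (RCLike.ofReal_ne_zero.2 h)]

theorem inner_leftSingularVector_apply (k : Fin (Module.finrank 𝕜 E)) (x : E) :
    inner 𝕜 (leftSingularVector T k) (T x) =
      T.singularValues k * inner 𝕜 (rightSingularBasis T k) x := by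
  rw [leftSingularVector, inner_smul_left, inner_apply_rightSingularBasis, ← RCLike.ofReal_inv,
    RCLike.conj_ofReal, RCLike.ofReal_inv, sq, ← mul_assoc, ← mul_assoc, inv_mul_mul_self]

theorem orthonormal_leftSingularVector :
    Orthonormal 𝕜 fun k : {k : Fin (Module.finrank 𝕜 E) // T.singularValues k ≠ 0} =>
      leftSingularVector T k := by
  classical
  rw [orthonormal_iff_ite]
  rintro ⟨k, hk⟩ ⟨l, hl⟩
  have hl' : (T.singularValues l : 𝕜) ≠ 0 := RCLike.ofReal_ne_zero.2 hl
  refine mul_left_cancel₀ hl' ?_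
  rw [← inner_smul_right, ← apply_rightSingularBasis, inner_leftSingularVector_apply,
    orthonormal_iff_ite.1 (rightSingularBasis T).orthonormal]
  by_cases h : k = l <;> simp [h]

theorem singularValues_mul_norm_leftSingularVector_sq (k : Fin (Module.finrank 𝕜 E)) :
    T.singularValues k * ‖leftSingularVector T k‖ ^ 2 = T.singularValues k := by
  by_cases h : T.singularValues k = 0
  · rw [h, zero_mul]
  · rw [(orthonormal_leftSingularVector T).1 ⟨k, h⟩, one_pow, mul_one]

theorem sum_norm_inner_leftSingularVector_sq_le (y : F) :
    ∑ k, ‖inner 𝕜 (leftSingularVector T k) y‖ ^ 2 ≤ ‖y‖ ^ 2 := by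
  classical
  have hzero : ∀ k : Fin (Module.finrank 𝕜 E),
      ‖inner 𝕜 (leftSingularVector T k) y‖ ^ 2 ≠ 0 → T.singularValues k ≠ 0 := by
    intro k hk h
    simp [leftSingularVector, h] at hk
  rw [← Finset.sum_filter_of_ne fun k _ => hzero k,
    Finset.sum_subtype (p := fun k : Fin _ => T.singularValues k ≠ 0) (F := inferInstance) _
      (by simp)]
  exact (orthonormal_leftSingularVector T).sum_inner_products_le y

theorem sum_norm_inner_mul_norm_inner_le (x : E) (y : F) :
    ∑ k, ‖inner 𝕜 x (rightSingularBasis T k)‖ * ‖inner 𝕜 (leftSingularVector T k) y‖ ≤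
      ‖x‖ * ‖y‖ := by
  refine (Real.sum_mul_le_sqrt_mul_sqrt _ _ _).trans ?_
  rw [(rightSingularBasis T).sum_sq_norm_inner_left, Real.sqrt_sq (norm_nonneg x)]
  gcongr
  exact Real.sqrt_le_iff.2 ⟨norm_nonneg y, sum_norm_inner_leftSingularVector_sq_le T y⟩

theorem exists_balanced_singular_decomposition :
    ∃ (p : ℕ → F) (q : ℕ → E), (∀ k, ‖p k‖ ^ 2 = T.singularValues k) ∧
      (∀ k, ‖q k‖ ^ 2 = T.singularValues k) ∧
      ∀ x, HasSum (fun k => inner 𝕜 (q k) x • p k) (T x) := by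
  set s : ℕ → 𝕜 := fun k => (√(T.singularValues k) : 𝕜)
  have hs : ∀ k, ‖s k‖ ^ 2 = T.singularValues k := fun k => by
    rw [RCLike.norm_ofReal, sq_abs, Real.sq_sqrt (T.singularValues_nonneg k)]
  have hss : ∀ k, s k * s k = T.singularValues k := fun k => by
    rw [← RCLike.ofReal_mul, Real.mul_self_sqrt (T.singularValues_nonneg k)]
  set p : ℕ → F := fun k =>
    if h : k < Module.finrank 𝕜 E then s k • leftSingularVector T ⟨k, h⟩ else 0 with hp
  set q : ℕ → E := fun k =>
    if h : k < Module.finrank 𝕜 E then s k • rightSingularBasis T ⟨k, h⟩ else 0 with hq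
  refine ⟨p, q, fun k => ?_, fun k => ?_, fun x => ?_⟩
  · simp only [hp]
    split_ifs with h
    · rw [norm_smul, mul_pow, hs]
      exact singularValues_mul_norm_leftSingularVector_sq T ⟨k, h⟩
    · rw [T.singularValues_of_finrank_le (not_lt.1 h), norm_zero, zero_pow two_ne_zero]
  · simp only [hq]
    split_ifs with h
    · rw [norm_smul, mul_pow, hs, (rightSingularBasis T).orthonormal.1, one_pow, mul_one]
    · rw [T.singularValues_of_finrank_le (not_lt.1 h), norm_zero, zero_pow two_ne_zero]
  · have hTx : T x = ∑ k ∈ Finset.range (Module.finrank 𝕜 E), inner 𝕜 (q k) x • p k := by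
      conv_lhs => rw [← (rightSingularBasis T).sum_repr' x, map_sum]
      rw [Finset.sum_range]
      refine Finset.sum_congr rfl fun k _ => ?_
      simp only [p, q, Fin.is_lt, dite_true, Fin.eta, map_smul, apply_rightSingularBasis,
        smul_smul, inner_smul_left, s, RCLike.conj_ofReal]
      rw [← hss]
      congr 1
      ring
    exact hTx ▸ hasSum_sum_of_ne_finset_zero fun k hk => by
      simp only [p, dif_neg (Finset.mem_range.not.1 hk), smul_zero]

theorem finite_support_of_norm_sq_eq_singularValues {G : Type*} [NormedAddCommGroup G] {c : ℕ → G}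
    (hc : ∀ k, ‖c k‖ ^ 2 = T.singularValues k) : (Function.support c).Finite :=
  T.singularValues.hasFiniteSupport.subset fun k hk h => hk <| by
    rw [← norm_eq_zero, ← sq_eq_zero_iff, hc, h]

end SingularVectors

section NuclearBound

theorem re_inner_self_starProjection {𝕜 E : Type*} [RCLike 𝕜] [NormedAddCommGroup E]
    [InnerProductSpace 𝕜 E] (K : Submodule 𝕜 E) [K.HasOrthogonalProjection] (x : E) :
    RCLike.re (inner 𝕜 x (K.starProjection x)) = ‖K.starProjection x‖ ^ 2 := by
  rw [inner_re_symm, K.re_inner_starProjection_eq_normSq, Submodule.starProjection_apply,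
    Submodule.coe_norm]

theorem sum_norm_starProjection_sq {𝕜 E ι : Type*} [RCLike 𝕜] [NormedAddCommGroup E]
    [InnerProductSpace 𝕜 E] [FiniteDimensional 𝕜 E] [Fintype ι] (b : OrthonormalBasis ι 𝕜 E)
    (K : Submodule 𝕜 E) : ∑ k, ‖K.starProjection (b k)‖ ^ 2 = Module.finrank 𝕜 K := by
  have hproj : LinearMap.IsProj K (K.starProjection : E →ₗ[𝕜] E) :=
    ⟨K.starProjection_apply_mem, fun x => Submodule.starProjection_eq_self_iff.2⟩
  have htrace := hproj.trace
  rw [LinearMap.trace_eq_sum_inner _ b] at htrace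
  have h := congrArg RCLike.re htrace
  rw [map_sum, RCLike.natCast_re] at h
  rw [← h]
  exact Finset.sum_congr rfl fun k _ => (re_inner_self_starProjection K (b k)).symm

/-- The bathtub principle: a density `d` with values in `[0, 1]` whose mass is at least the
cardinality of `A` collects the least total `s` by filling `A`, where `s` is smallest. -/
theorem sum_le_sum_mul_of_card_le_sum {ι : Type*} [Fintype ι] {A : Finset ι} {s d : ι → ℝ} {c : ℝ}
    (hc : 0 ≤ c) (hA : ∀ i ∈ A, s i ≤ c) (hAc : ∀ i ∉ A, c ≤ s i) (hd0 : ∀ i, 0 ≤ d i)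
    (hd1 : ∀ i, d i ≤ 1) (hd : (A.card : ℝ) ≤ ∑ i, d i) : ∑ i ∈ A, s i ≤ ∑ i, s i * d i := by
  classical
  have hterm : ∀ i, c * (d i - if i ∈ A then 1 else 0) ≤ s i * d i - if i ∈ A then s i else 0 := by
    intro i
    split_ifs with h
    · nlinarith [hA i h, hd1 i]
    · nlinarith [hAc i h, hd0 i]
  have hsum := Finset.sum_le_sum fun i (_ : i ∈ Finset.univ) => hterm i
  simp only [← Finset.mul_sum, Finset.sum_sub_distrib, Finset.sum_ite_mem, Finset.univ_inter,
    Finset.sum_const, nsmul_eq_mul, mul_one] at hsum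
  linarith [mul_nonneg hc (sub_nonneg.2 hd)]

/-- Abel summation: a monotone weight is a nonnegative combination of indicators of tails. -/
theorem sum_range_mul_le_tsum_mul {w s a : ℕ → ℝ} {n : ℕ} (hw : Monotone w) (hw0 : 0 ≤ w 0)
    (ha0 : ∀ l, 0 ≤ a l) (ha : Summable a) (hwa : Summable fun l => w l * a l)
    (htail : ∀ N, ∑ k ∈ Finset.range (n - N), s (k + N) ≤ ∑' l, a (l + N)) :
    ∑ k ∈ Finset.range n, w k * s k ≤ ∑' l, w l * a l := by
  induction n generalizing w s a with
  | zero =>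
    rw [Finset.range_zero, Finset.sum_empty]
    exact tsum_nonneg fun l => mul_nonneg (hw0.trans (hw (Nat.zero_le l))) (ha0 l)
  | succ n ih =>
    have ha' : Summable fun l => a (l + 1) := (summable_nat_add_iff 1).2 ha
    have hwa' : Summable fun l => (w (l + 1) - w 0) * a (l + 1) := by
      simp only [sub_mul]
      exact ((summable_nat_add_iff 1).2 hwa).sub (ha'.mul_left _)
    have hshift := ih (w := fun l => w (l + 1) - w 0) (s := fun k => s (k + 1))
      (fun k l hkl => sub_le_sub_right (hw (Nat.succ_le_succ hkl)) _)
      (sub_nonneg.2 (hw (Nat.zero_le _))) (fun l => ha0 (l + 1)) ha' hwa'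
      fun N => by simpa [add_assoc] using htail (N + 1)
    have htotal : w 0 * ∑ k ∈ Finset.range (n + 1), s k ≤ w 0 * ∑' l, a l :=
      mul_le_mul_of_nonneg_left (by simpa using htail 0) hw0
    calc ∑ k ∈ Finset.range (n + 1), w k * s k
        = w 0 * ∑ k ∈ Finset.range (n + 1), s k +
            ∑ k ∈ Finset.range n, (w (k + 1) - w 0) * s (k + 1) := by
          simp only [Finset.sum_range_succ', sub_mul, Finset.sum_sub_distrib, ← Finset.mul_sum]
          ring
      _ ≤ w 0 * ∑' l, a l + ∑' l, (w (l + 1) - w 0) * a (l + 1) := add_le_add htotal hshift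
      _ = ∑' l, w l * a l := by
          rw [hwa.tsum_eq_zero_add, ha.tsum_eq_zero_add, mul_add, add_assoc, ← tsum_mul_left,
            ← (ha'.mul_left _).tsum_add hwa']
          simp only [← add_mul, add_sub_cancel]

variable {𝕜 E F : Type*} [RCLike 𝕜]
  [NormedAddCommGroup E] [InnerProductSpace 𝕜 E] [FiniteDimensional 𝕜 E]
  [NormedAddCommGroup F] [InnerProductSpace 𝕜 F] [FiniteDimensional 𝕜 F]
  {T : E →ₗ[𝕜] F} {u : ℕ → F} {v : ℕ → E}

theorem sum_singularValues_tail_le_sum_mul (T : E →ₗ[𝕜] F) {K : Submodule 𝕜 E} {N : ℕ}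
    (hK : Module.finrank 𝕜 K ≤ N) :
    ∑ k ∈ Finset.range (Module.finrank 𝕜 E - N), T.singularValues (k + N) ≤
      ∑ k : Fin (Module.finrank 𝕜 E),
        T.singularValues k * ‖Kᗮ.starProjection (rightSingularBasis T k)‖ ^ 2 := by
  set n := Module.finrank 𝕜 E
  set A : Finset (Fin n) := Finset.univ.filter fun k => N ≤ k
  have hmap : A.map Fin.valEmbedding = Finset.Ico N n := by
    ext k
    simp only [A, Finset.mem_map, Finset.mem_filter_univ, Fin.valEmbedding_apply, Finset.mem_Ico]
    exact ⟨fun ⟨i, hi, hik⟩ => hik ▸ ⟨hi, i.is_lt⟩, fun h => ⟨⟨k, h.2⟩, h.1, rfl⟩⟩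
  have hsum : ∑ k ∈ Finset.range (n - N), T.singularValues (k + N) =
      ∑ k ∈ A, T.singularValues k := by
    simp only [add_comm _ N]
    rw [← Finset.sum_Ico_eq_sum_range, ← hmap, Finset.sum_map]
    rfl
  have hcard : (A.card : ℝ) ≤ ∑ k, ‖Kᗮ.starProjection (rightSingularBasis T k)‖ ^ 2 := by
    have hdim : Module.finrank 𝕜 K + Module.finrank 𝕜 Kᗮ = n := K.finrank_add_finrank_orthogonal
    rw [sum_norm_starProjection_sq, ← Finset.card_map Fin.valEmbedding, hmap, Nat.card_Ico]
    exact_mod_cast (by omega : n - N ≤ Module.finrank 𝕜 Kᗮ)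
  rw [hsum]
  refine sum_le_sum_mul_of_card_le_sum (ι := Fin n) (s := fun k => T.singularValues k)
    (T.singularValues_nonneg N)
    (fun k hk => T.singularValues_antitone (Finset.mem_filter_univ k |>.1 hk))
    (fun k hk => T.singularValues_antitone ?_) (fun k => sq_nonneg _) (fun k => ?_) hcard
  · exact (not_le.1 fun h => hk ((Finset.mem_filter_univ k).2 h)).le
  · refine pow_le_one₀ (norm_nonneg _) ?_
    exact (Submodule.norm_starProjection_apply_le _ _).trans_eq
      ((rightSingularBasis T).orthonormal.1 k)

/-- Compressing to the orthogonal complement of the first `N` of the `v l` discards the first `N`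
rank one terms, but only `N` of the singular values. -/
theorem sum_singularValues_tail_le_tsum (hT : ∀ x, HasSum (fun l => inner 𝕜 (v l) x • u l) (T x))
    (huv : Summable fun l => ‖u l‖ * ‖v l‖) (N : ℕ) :
    ∑ k ∈ Finset.range (Module.finrank 𝕜 E - N), T.singularValues (k + N) ≤
      ∑' l, ‖u (l + N)‖ * ‖v (l + N)‖ := by
  set K : Submodule 𝕜 E := Submodule.span 𝕜 (range fun l : Fin N => v l)
  have hK : Module.finrank 𝕜 K ≤ N :=
    (finrank_range_le_card fun l : Fin N => v l).trans_eq (Fintype.card_fin N)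
  set P := Kᗮ.starProjection
  set q := rightSingularBasis T
  set p := leftSingularVector T
  set f : ℕ → ℝ := fun l => ∑ k, RCLike.re (inner 𝕜 (P (v l)) (q k) * inner 𝕜 (p k) (u l)) with hf
  have hsum : HasSum f (∑ k : Fin _, T.singularValues k * ‖P (q k)‖ ^ 2) := by
    refine hasSum_sum fun k _ => ?_
    have h := ((hT (P (q k))).mapL (innerSL 𝕜 (p k))).mapL RCLike.reCLM
    simp only [innerSL_apply_apply, inner_smul_right, RCLike.reCLM_apply, p, q,
      inner_leftSingularVector_apply, RCLike.re_ofReal_mul] at h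
    rw [re_inner_self_starProjection] at h
    simpa only [P, ← Submodule.inner_starProjection_left_eq_right] using h
  have hzero : ∑ l ∈ Finset.range N, f l = 0 := by
    refine Finset.sum_eq_zero fun l hl => ?_
    have hv : v l ∈ K := Submodule.subset_span ⟨⟨l, Finset.mem_range.1 hl⟩, rfl⟩
    have hP : P (v l) = 0 := by
      rw [Submodule.starProjection_apply_eq_zero_iff, Submodule.orthogonal_orthogonal]
      exact hv
    simp [hf, hP]
  have hle : ∀ l, f l ≤ ‖u l‖ * ‖v l‖ := by
    intro l
    calc f l ≤ ∑ k, ‖inner 𝕜 (P (v l)) (q k)‖ * ‖inner 𝕜 (p k) (u l)‖ :=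
          Finset.sum_le_sum fun k _ => (RCLike.re_le_norm _).trans_eq (norm_mul _ _)
      _ ≤ ‖P (v l)‖ * ‖u l‖ := sum_norm_inner_mul_norm_inner_le T _ _
      _ ≤ ‖v l‖ * ‖u l‖ := by
          gcongr
          exact Submodule.norm_starProjection_apply_le _ _
      _ = ‖u l‖ * ‖v l‖ := mul_comm _ _
  have htail := (hasSum_nat_add_iff' N).2 hsum
  rw [hzero, sub_zero] at htail
  exact (sum_singularValues_tail_le_sum_mul T hK).trans
    (hasSum_le (fun l => hle (l + N)) htail ((summable_nat_add_iff N).2 huv).hasSum)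

theorem sum_weight_mul_singularValues_le {w : ℕ → ℝ} (hw : Monotone w) (hw0 : 0 < w 0)
    (hT : ∀ x, HasSum (fun l => inner 𝕜 (v l) x • u l) (T x))
    (huv : Summable fun l => w l * (‖u l‖ * ‖v l‖)) :
    ∑ k ∈ Finset.range (Module.finrank 𝕜 E), w k * T.singularValues k ≤
      ∑' l, w l * (‖u l‖ * ‖v l‖) := by
  have hsummable : Summable fun l => ‖u l‖ * ‖v l‖ := by
    refine (huv.mul_left (w 0)⁻¹).of_nonneg_of_le (fun l => by positivity) fun l => ?_
    rw [← div_eq_inv_mul, le_div_iff₀' hw0]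
    exact mul_le_mul_of_nonneg_right (hw (Nat.zero_le l)) (by positivity)
  exact sum_range_mul_le_tsum_mul hw hw0.le (fun l => by positivity) hsummable huv
    (sum_singularValues_tail_le_tsum hT hsummable)

end NuclearBound

section TrigonometricSystem

/-- The frequency of `trigFun j`. -/
def freq (j : ℕ) : ℕ := j / 2 + 1

/-- The involution that exchanges the indices of the sine and the cosine of equal frequency. -/
def partner (j : ℕ) : ℕ := if Even j then j + 1 else j - 1

/-- The sign in the differentiation rules `sin' = cos` and `cos' = -sin`. -/
noncomputable def derivSign (j : ℕ) : ℝ := if Even j then 1 else -1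

/-- The conjugate of `trigFun j`: its derivative, normalized by the factor `2π freq j`. -/
noncomputable def conjFun (j : ℕ) (t : ℝ) : ℝ := derivSign j * trigFun (partner j) t

theorem freq_pos (j : ℕ) : (0 : ℝ) < freq j := by
  unfold freq; positivity

theorem monotone_freq : Monotone freq := fun _ _ h =>
  Nat.succ_le_succ (Nat.div_le_div_right h)

theorem involutive_partner : Function.Involutive partner := fun j => by
  unfold partner; grind

theorem freq_partner (j : ℕ) : freq (partner j) = freq j := by
  unfold partner freq; grind

theorem eq_or_eq_partner_of_freq_eq {i j : ℕ} (h : freq i = freq j) : i = j ∨ i = partner j := by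
  unfold freq at h; unfold partner; grind

theorem derivSign_partner (j : ℕ) : derivSign (partner j) = -derivSign j := by
  unfold derivSign partner; grind

theorem derivSign_mul_self (j : ℕ) : derivSign j * derivSign j = 1 := by
  unfold derivSign; split_ifs <;> norm_num

theorem conjFun_partner (j : ℕ) (t : ℝ) : conjFun (partner j) t = -(derivSign j * trigFun j t) := by
  rw [conjFun, derivSign_partner, involutive_partner, neg_mul]

theorem hasDerivAt_trigFun (j : ℕ) (t : ℝ) :
    HasDerivAt (trigFun j) (2 * Real.pi * freq j * conjFun j t) t := by
  have hphase : HasDerivAt (fun t : ℝ => 2 * Real.pi * (freq j : ℝ) * t)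
      (2 * Real.pi * freq j) t := by
    simpa using (hasDerivAt_id t).const_mul (2 * Real.pi * (freq j : ℝ))
  have hfreq := freq_partner j
  by_cases h : Even j
  · have hodd : ¬Even (partner j) := by unfold partner; grind
    have heq : trigFun j = fun t => √2 * Real.sin (2 * Real.pi * freq j * t) :=
      funext fun t => if_pos h
    rw [heq, conjFun, derivSign, if_pos h, trigFun, if_neg hodd]
    change HasDerivAt _ (_ * (1 * (√2 * Real.cos (2 * Real.pi * freq (partner j) * t)))) t
    rw [hfreq]
    exact (hphase.sin.const_mul √2).congr_deriv (by ring)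
  · have heven : Even (partner j) := by unfold partner; grind
    have heq : trigFun j = fun t => √2 * Real.cos (2 * Real.pi * freq j * t) :=
      funext fun t => if_neg h
    rw [heq, conjFun, derivSign, if_neg h, trigFun, if_pos heven]
    change HasDerivAt _ (_ * (-1 * (√2 * Real.sin (2 * Real.pi * freq (partner j) * t)))) t
    rw [hfreq]
    exact (hphase.cos.const_mul √2).congr_deriv (by ring)

theorem hasDerivAt_conjFun (j : ℕ) (t : ℝ) :
    HasDerivAt (conjFun j) (-(2 * Real.pi * freq j * trigFun j t)) t := by
  refine ((hasDerivAt_trigFun (partner j) t).const_mul (derivSign j)).congr_deriv ?_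
  rw [conjFun_partner, freq_partner]
  linear_combination -(2 * Real.pi * freq j * trigFun j t) * derivSign_mul_self j

theorem trigFun_one (j : ℕ) : trigFun j 1 = trigFun j 0 := by
  have hperiod : 2 * Real.pi * ((j / 2 + 1 : ℕ) : ℝ) * 1 =
      0 + ((j / 2 + 1 : ℕ) : ℝ) * (2 * Real.pi) := by ring
  unfold trigFun
  rw [mul_zero, hperiod, Real.sin_add_nat_mul_two_pi, Real.cos_add_nat_mul_two_pi]

theorem trigFun_sq_add_conjFun_sq (j : ℕ) (t : ℝ) : trigFun j t ^ 2 + conjFun j t ^ 2 = 2 := by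
  have hangle := Real.sin_sq_add_cos_sq (2 * Real.pi * freq j * t)
  have hsqrt : √2 ^ 2 = (2 : ℝ) := Real.sq_sqrt zero_le_two
  have hsign := derivSign_mul_self j
  have hfreq := freq_partner j
  unfold freq at hangle hfreq
  have hparity : Even (partner j) ↔ ¬Even j := by unfold partner; grind
  unfold conjFun trigFun
  simp only [hparity, hfreq]
  split_ifs <;> grind

theorem continuous_trigFun (j : ℕ) : Continuous (trigFun j) :=
  continuous_iff_continuousAt.2 fun t => (hasDerivAt_trigFun j t).continuousAt

theorem absolutelyContinuousOnInterval_trigFun (j : ℕ) (a b : ℝ) :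
    AbsolutelyContinuousOnInterval (trigFun j) a b := by
  refine ContDiffOn.absolutelyContinuousOnInterval (ContDiff.contDiffOn ?_)
  unfold trigFun
  split_ifs <;> fun_prop

theorem integral_mul_trigFun {x : ℝ → ℝ} (hx : AbsolutelyContinuousOnInterval x 0 1)
    (h01 : x 1 = x 0) (j : ℕ) :
    2 * Real.pi * freq j * ∫ t in (0 : ℝ)..1, x t * trigFun j t =
      ∫ t in (0 : ℝ)..1, deriv x t * conjFun j t := by
  have hparts := hx.integral_mul_deriv_eq_deriv_mul
    ((absolutelyContinuousOnInterval_trigFun (partner j) 0 1).const_mul (derivSign j))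
  change ∫ t in (0 : ℝ)..1, x t * deriv (conjFun j) t =
    x 1 * (derivSign j * trigFun (partner j) 1) - x 0 * (derivSign j * trigFun (partner j) 0) -
      ∫ t in (0 : ℝ)..1, deriv x t * conjFun j t at hparts
  rw [h01, trigFun_one, sub_self, zero_sub, ← neg_eq_iff_eq_neg, ← intervalIntegral.integral_neg]
    at hparts
  rw [← hparts, ← intervalIntegral.integral_const_mul]
  congr 1 with t
  rw [(hasDerivAt_conjFun j t).deriv]
  ring

theorem integral_trigFun (j : ℕ) : ∫ t in (0 : ℝ)..1, trigFun j t = 0 := by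
  have hparts := integral_mul_trigFun (x := fun _ => 1)
    (LipschitzWith.const (1 : ℝ)).lipschitzOnWith.absolutelyContinuousOnInterval rfl j
  simpa [Real.pi_ne_zero, (freq_pos j).ne'] using hparts

theorem freq_mul_integral_trigFun_mul_trigFun (i j : ℕ) :
    freq j * ∫ t in (0 : ℝ)..1, trigFun i t * trigFun j t =
      freq i * ∫ t in (0 : ℝ)..1, conjFun i t * conjFun j t := by
  have hparts := integral_mul_trigFun (absolutelyContinuousOnInterval_trigFun i 0 1)
    (trigFun_one i) j
  simp only [(hasDerivAt_trigFun i _).deriv, mul_assoc (2 * Real.pi * (freq i : ℝ)),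
    intervalIntegral.integral_const_mul] at hparts
  refine mul_left_cancel₀ Real.two_pi_pos.ne' ?_
  simpa only [mul_assoc] using hparts

/-- Integrating by parts on either factor, the Gram matrices `G` of the `trigFun j` and `C` of the
`conjFun j` satisfy `f j * G i j = f i * C i j` and `f i * G i j = f j * C i j`. -/
theorem integral_trigFun_mul_trigFun (i j : ℕ) :
    ∫ t in (0 : ℝ)..1, trigFun i t * trigFun j t = if i = j then 1 else 0 := by
  have hij := freq_mul_integral_trigFun_mul_trigFun i j
  have hfreq := freq_pos j
  split_ifs with h
  · subst h
    have hparts := mul_left_cancel₀ hfreq.ne' hij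
    have hcont : Continuous fun t => trigFun i t ^ 2 := (continuous_trigFun i).pow 2
    have hcont' : Continuous fun t => conjFun i t ^ 2 :=
      (continuous_const.mul (continuous_trigFun _)).pow 2
    have hsum : (∫ t in (0 : ℝ)..1, trigFun i t ^ 2) + ∫ t in (0 : ℝ)..1, conjFun i t ^ 2 = 2 := by
      rw [← intervalIntegral.integral_add (hcont.intervalIntegrable _ _)
        (hcont'.intervalIntegrable _ _)]
      simp [trigFun_sq_add_conjFun_sq]
    simp only [sq] at hsum
    linarith
  by_cases hf : freq i = freq j
  · obtain rfl := (eq_or_eq_partner_of_freq_eq hf).resolve_left h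
    have hconj : ∀ t,
        conjFun (partner j) t * conjFun j t = -(trigFun (partner j) t * trigFun j t) := by
      intro t
      rw [conjFun_partner, conjFun]
      linear_combination -(trigFun (partner j) t * trigFun j t) * derivSign_mul_self j
    simp only [hconj, intervalIntegral.integral_neg, hf] at hij
    exact self_eq_neg.1 (mul_left_cancel₀ hfreq.ne' hij)
  · have hji := freq_mul_integral_trigFun_mul_trigFun j i
    simp only [mul_comm (trigFun j _), mul_comm (conjFun j _)] at hji
    have hsq : ((freq i : ℝ) ^ 2 - (freq j : ℝ) ^ 2) *
        ∫ t in (0 : ℝ)..1, trigFun i t * trigFun j t = 0 := by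
      linear_combination (freq i : ℝ) * hji - freq j * hij
    refine (mul_eq_zero.1 hsq).resolve_left (sub_ne_zero.2 fun h => hf ?_)
    exact_mod_cast (sq_eq_sq₀ (freq_pos i).le hfreq.le).1 h

end TrigonometricSystem

section HilbertExpansion

variable {𝕜 E ι κ : Type*} [RCLike 𝕜] [NormedAddCommGroup E] [InnerProductSpace 𝕜 E] {e : ι → E}

theorem hasSum_inner_smul_of_hasSum_smul (he : Orthonormal 𝕜 e) {a : ι → 𝕜} {f : E}
    (hf : HasSum (fun l => a l • e l) f) : HasSum (fun l => inner 𝕜 (e l) f • e l) f := by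
  classical
  have hcoeff : ∀ l, inner 𝕜 (e l) f = a l := by
    intro l
    have hinner := hf.mapL (innerSL 𝕜 (e l))
    simp only [innerSL_apply_apply, inner_smul_right, orthonormal_iff_ite.1 he, mul_ite, mul_one,
      mul_zero] at hinner
    exact hinner.unique (hasSum_single l fun k hk => if_neg hk.symm) |>.trans (if_pos rfl)
  simpa only [hcoeff] using hf

theorem hasSum_norm_inner_sq {f : E} (hf : HasSum (fun l => inner 𝕜 (e l) f • e l) f) :
    HasSum (fun l => ‖inner 𝕜 (e l) f‖ ^ 2) (‖f‖ ^ 2) := by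
  have hinner := (hf.mapL (innerSL 𝕜 f)).mapL RCLike.reCLM
  simpa only [innerSL_apply_apply, inner_smul_right, RCLike.reCLM_apply, inner_mul_symm_re_eq_norm,
    norm_mul, norm_inner_symm f, ← sq, inner_self_eq_norm_sq] using hinner

variable (𝕜 e) in
/-- The `l`-th generalized Fourier coefficients, with respect to `e`, of a finite family of vectors,
collected into one vector. -/
noncomputable def coeffVec (W : κ → E) (l : ι) : EuclideanSpace 𝕜 κ :=
  WithLp.toLp 2 fun k => inner 𝕜 (e l) (W k)

theorem hasSum_norm_coeffVec_sq [Fintype κ] {W : κ → E}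
    (hW : ∀ k, HasSum (fun l => inner 𝕜 (e l) (W k) • e l) (W k)) :
    HasSum (fun l => ‖coeffVec 𝕜 e W l‖ ^ 2) (∑ k, ‖W k‖ ^ 2) := by
  simp only [EuclideanSpace.norm_sq_eq]
  exact hasSum_sum fun k _ => hasSum_norm_inner_sq (hW k)

theorem exists_mem_span_coeffVec_eq (he : Orthonormal 𝕜 e) {c : ι → EuclideanSpace 𝕜 κ}
    (hc : (Function.support c).Finite) :
    ∃ W : κ → E, (∀ k, W k ∈ Submodule.span 𝕜 (range e)) ∧ coeffVec 𝕜 e W = c := by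
  have hck : ∀ k, (Function.support fun l => c l k).Finite := fun k =>
    hc.subset fun l hl h => hl (by simp only [h, PiLp.zero_apply])
  refine ⟨fun k => Finsupp.linearCombination 𝕜 e (Finsupp.ofSupportFinite _ (hck k)),
    fun k => ?_, ?_⟩
  · exact Finsupp.range_linearCombination 𝕜 (v := e) ▸ LinearMap.mem_range_self _ _
  · ext l k
    exact he.inner_right_finsupp _ l

end HilbertExpansion

section AdmissibleControls

theorem integral_unitMeasure (f : ℝ → ℝ) : ∫ t, f t ∂unitMeasure = ∫ t in (0 : ℝ)..1, f t := by
  rw [intervalIntegral.integral_of_le zero_le_one, integral_Icc_eq_integral_Ioc]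

theorem intervalIntegral_congr_unitMeasure {f g : ℝ → ℝ} (h : ∀ᵐ t ∂unitMeasure, f t = g t) :
    ∫ t in (0 : ℝ)..1, f t = ∫ t in (0 : ℝ)..1, g t := by
  rw [← integral_unitMeasure, ← integral_unitMeasure]
  exact integral_congr_ae h

theorem inner_toLp_left {f : ℝ → ℝ} (hf : MemLp f 2 unitMeasure) (g : L2) :
    inner ℝ (hf.toLp f) g = ∫ t in (0 : ℝ)..1, f t * g t := by
  rw [MeasureTheory.L2.inner_def, integral_unitMeasure]
  refine intervalIntegral_congr_unitMeasure ?_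
  filter_upwards [hf.coeFn_toLp] with t ht
  rw [ht, RCLike.inner_apply', conj_trivial]

theorem norm_sq_eq_integral (f : L2) : ‖f‖ ^ 2 = ∫ t in (0 : ℝ)..1, f t ^ 2 := by
  have h := inner_toLp_left (Lp.memLp f) f
  rw [Lp.toLp_coeFn, real_inner_self_eq_norm_sq] at h
  simpa only [sq] using h

theorem inner_trigBasis (j : ℕ) (g : L2) :
    inner ℝ (trigBasis j) g = ∫ t in (0 : ℝ)..1, trigFun j t * g t :=
  inner_toLp_left (memLp_trigFun j) g

/-- The functions `conjFun j` in `L²[0, 1]`: up to signs and order, the trigonometric basis. -/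
noncomputable def conjBasis (j : ℕ) : L2 := derivSign j • trigBasis (partner j)

theorem inner_conjBasis (j : ℕ) (g : L2) :
    inner ℝ (conjBasis j) g = ∫ t in (0 : ℝ)..1, conjFun j t * g t := by
  simp only [conjBasis, real_inner_smul_left, inner_trigBasis, conjFun, mul_assoc,
    intervalIntegral.integral_const_mul]

theorem integral_mul_trigBasis (x : ℝ → ℝ) (j : ℕ) :
    ∫ t in (0 : ℝ)..1, x t * trigBasis j t = ∫ t in (0 : ℝ)..1, x t * trigFun j t := by
  refine intervalIntegral_congr_unitMeasure ?_
  filter_upwards [(memLp_trigFun j).coeFn_toLp] with t ht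
  rw [trigBasis, ht]

theorem orthonormal_trigBasis : Orthonormal ℝ trigBasis := by
  rw [orthonormal_iff_ite]
  intro i j
  rw [inner_trigBasis, integral_mul_trigBasis, integral_trigFun_mul_trigFun]

theorem orthonormal_conjBasis : Orthonormal ℝ conjBasis := by
  rw [orthonormal_iff_ite]
  intro i j
  rw [conjBasis, conjBasis, real_inner_smul_left, real_inner_smul_right,
    orthonormal_iff_ite.1 orthonormal_trigBasis]
  simp only [involutive_partner.injective.eq_iff]
  split_ifs with h
  · rw [h, mul_one, derivSign_mul_self]
  · rw [mul_zero, mul_zero]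

theorem hasSum_inner_trigBasis_smul {f : L2} (hf : f ∈ admissible) :
    HasSum (fun l => inner ℝ (trigBasis l) f • trigBasis l) f :=
  let ⟨_, _, ha⟩ := hf
  hasSum_inner_smul_of_hasSum_smul orthonormal_trigBasis ha

theorem hasSum_inner_conjBasis_smul {f : L2} (hf : f ∈ admissible) :
    HasSum (fun l => inner ℝ (conjBasis l) f • conjBasis l) f := by
  have hterm : ∀ l, inner ℝ (conjBasis l) f • conjBasis l =
      inner ℝ (trigBasis (partner l)) f • trigBasis (partner l) := fun l => by
    rw [conjBasis, real_inner_smul_left, smul_smul, mul_right_comm, derivSign_mul_self, one_mul]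
  have hperm := involutive_partner.toPerm.hasSum_iff.2 (hasSum_inner_trigBasis_smul hf)
  exact hperm.congr_fun hterm

theorem mem_admissible_of_mem_span {f : L2} (hf : f ∈ Submodule.span ℝ (range trigBasis)) :
    f ∈ admissible := by
  obtain ⟨a, rfl⟩ := Finsupp.mem_span_range_iff_exists_finsupp.1 hf
  have hzero : ∀ l ∉ a.support, a l = 0 := fun l => Finsupp.notMem_support_iff.1
  exact ⟨a, summable_of_ne_finset_zero fun l hl => by rw [hzero l hl, sq, zero_mul],
    hasSum_sum_of_ne_finset_zero fun l hl => by rw [hzero l hl, zero_smul]⟩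

theorem span_conjBasis_le : Submodule.span ℝ (range conjBasis) ≤
    Submodule.span ℝ (range trigBasis) := by
  rw [Submodule.span_le]
  rintro _ ⟨l, rfl⟩
  exact Submodule.smul_mem _ _ (Submodule.subset_span (mem_range_self _))

theorem integral_eq_zero_of_mem_admissible {f : L2} (hf : f ∈ admissible) :
    ∫ t in (0 : ℝ)..1, f t = 0 := by
  have hone : MemLp (fun _ : ℝ => (1 : ℝ)) 2 unitMeasure := memLp_const 1
  have hsum := (hasSum_inner_trigBasis_smul hf).mapL (innerSL ℝ (hone.toLp _))
  have hbasis : ∀ l, ∫ t in (0 : ℝ)..1, trigBasis l t = 0 := fun l => by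
    simpa only [one_mul, integral_trigFun] using integral_mul_trigBasis (fun _ => 1) l
  simp only [innerSL_apply_apply, inner_smul_right, inner_toLp_left, one_mul, hbasis,
    mul_zero] at hsum
  exact hsum.unique hasSum_zero

end AdmissibleControls

section Trajectories

variable {f g : L2} {x y z : ℝ → ℝ}

theorem memLp_of_absolutelyContinuousOnInterval (hx : AbsolutelyContinuousOnInterval x 0 1) :
    MemLp x 2 unitMeasure := by
  have hcont := hx.continuousOn
  obtain ⟨C, hC⟩ := hx.exists_bound
  rw [uIcc_of_le zero_le_one] at hcont hC
  exact MemLp.of_bound (hcont.aestronglyMeasurable measurableSet_Icc) C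
    (ae_restrict_of_forall_mem measurableSet_Icc hC)

theorem IsTrajectory.integral_deriv_x_mul {u v : ℝ → ℝ} (h : IsTrajectory u v x y z) (w : ℝ → ℝ) :
    ∫ t in (0 : ℝ)..1, deriv x t * w t = ∫ t in (0 : ℝ)..1, u t * w t := by
  refine intervalIntegral_congr_unitMeasure ?_
  filter_upwards [h.x_deriv] with t ht
  rw [ht.deriv]

theorem IsTrajectory.x_one_eq_zero (h : IsTrajectory f g x y z) (hf : f ∈ admissible) :
    x 1 = 0 := by
  have hx := h.integral_deriv_x_mul fun _ => 1
  simp only [mul_one] at hx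
  rwa [h.x_ac.integral_deriv_eq_sub, h.x_zero, sub_zero,
    integral_eq_zero_of_mem_admissible hf] at hx

/-- Adding `(x y)' = u y + v x`, whose integral vanishes, to `z' = v x - u y`. -/
theorem IsTrajectory.z_one_eq {u v : ℝ → ℝ} (h : IsTrajectory u v x y z) (hx : x 1 = 0) :
    z 1 = 2 * ∫ t in (0 : ℝ)..1, x t * v t := by
  have hz := h.z_ac.integral_deriv_eq_sub
  have hxy := h.x_ac.integral_deriv_mul_eq_sub h.y_ac
  rw [h.z_zero, sub_zero] at hz
  rw [hx, h.x_zero, zero_mul, zero_mul, sub_zero] at hxy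
  have hsum : z 1 = (∫ t in (0 : ℝ)..1, deriv z t) +
      ∫ t in (0 : ℝ)..1, deriv x t * y t + x t * deriv y t := by rw [hz, hxy, add_zero]
  rw [hsum, ← intervalIntegral.integral_add, ← intervalIntegral.integral_const_mul]
  · refine intervalIntegral_congr_unitMeasure ?_
    filter_upwards [h.x_deriv, h.y_deriv, h.z_deriv] with t htx hty htz
    rw [htx.deriv, hty.deriv, htz.deriv]
    ring
  · exact h.z_ac.intervalIntegrable_deriv
  · exact (h.x_ac.intervalIntegrable_deriv.mul_continuousOn h.y_ac.continuousOn).add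
      (h.y_ac.intervalIntegrable_deriv.continuousOn_mul h.x_ac.continuousOn)

theorem IsTrajectory.hasSum_z_one (h : IsTrajectory f g x y z) (hf : f ∈ admissible)
    (hg : g ∈ admissible) :
    HasSum (fun l => (Real.pi * freq l)⁻¹ * (inner ℝ (conjBasis l) f * inner ℝ (trigBasis l) g))
      (z 1) := by
  have hx1 := h.x_one_eq_zero hf
  have hx := memLp_of_absolutelyContinuousOnInterval h.x_ac
  have hsum := ((hasSum_inner_trigBasis_smul hg).mapL (innerSL ℝ (hx.toLp x))).mul_left 2
  simp only [innerSL_apply_apply, inner_smul_right, inner_toLp_left, integral_mul_trigBasis,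
    ← h.z_one_eq hx1] at hsum
  refine hsum.congr_fun fun l => ?_
  have hparts := integral_mul_trigFun h.x_ac (hx1.trans h.x_zero.symm) l
  simp only [h.integral_deriv_x_mul, mul_comm (f _), ← inner_conjBasis] at hparts
  have hfreq := freq_pos l
  rw [← hparts]
  field_simp

theorem exists_isTrajectory (f g : L2) : ∃ x y z : ℝ → ℝ, IsTrajectory f g x y z := by
  have hint : ∀ f : L2, IntervalIntegrable f volume 0 1 := fun f => by
    rw [intervalIntegrable_iff_integrableOn_Icc_of_le zero_le_one]
    exact (Lp.memLp f).integrable one_le_two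
  have hderiv : ∀ {w : ℝ → ℝ}, IntervalIntegrable w volume 0 1 →
      ∀ᵐ t ∂unitMeasure, HasDerivAt (fun t => ∫ s in (0 : ℝ)..t, w s) (w t) t := fun hw => by
    rw [ae_restrict_iff' measurableSet_Icc, ← uIcc_of_le zero_le_one]
    filter_upwards [hw.ae_hasDerivAt_integral] with t ht hmem using ht hmem 0 left_mem_uIcc
  have h0 : (0 : ℝ) ∈ uIcc (0 : ℝ) 1 := left_mem_uIcc
  have hx := (hint f).absolutelyContinuousOnInterval_intervalIntegral h0
  have hy := (hint g).absolutelyContinuousOnInterval_intervalIntegral h0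
  have hz : IntervalIntegrable (fun t => g t * (∫ s in (0 : ℝ)..t, f s) -
      f t * (∫ s in (0 : ℝ)..t, g s)) volume 0 1 :=
    ((hint g).mul_continuousOn hx.continuousOn).sub ((hint f).mul_continuousOn hy.continuousOn)
  exact ⟨_, _, _, hx, hy, hz.absolutelyContinuousOnInterval_intervalIntegral h0,
    intervalIntegral.integral_same, intervalIntegral.integral_same, intervalIntegral.integral_same,
    hderiv (hint f), hderiv (hint g), hderiv hz⟩

end Trajectories

section Reduction

variable {m n : ℕ} {H : Matrix (Fin m) (Fin n) ℝ}

theorem realizes_iff {U : Fin m → L2} {V : Fin n → L2} (hU : ∀ i, U i ∈ admissible)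
    (hV : ∀ j, V j ∈ admissible) :
    Realizes U V H ↔ ∀ i j, HasSum (fun l => (Real.pi * freq l)⁻¹ *
      (coeffVec ℝ conjBasis U l i * coeffVec ℝ trigBasis V l j)) (H i j) := by
  refine ⟨fun h i j => ?_, fun h i j => ?_⟩
  · obtain ⟨x, y, z, hxyz, hz⟩ := h i j
    exact hz ▸ hxyz.hasSum_z_one (hU i) (hV j)
  · obtain ⟨x, y, z, hxyz⟩ := exists_isTrajectory (U i) (V j)
    exact ⟨x, y, z, hxyz, (hxyz.hasSum_z_one (hU i) (hV j)).unique (h i j)⟩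

theorem hasSum_controlCost {U : Fin m → L2} {V : Fin n → L2} (hU : ∀ i, U i ∈ admissible)
    (hV : ∀ j, V j ∈ admissible) :
    HasSum (fun l => ‖coeffVec ℝ conjBasis U l‖ ^ 2 / m + ‖coeffVec ℝ trigBasis V l‖ ^ 2 / n)
      (controlCost U V) := by
  have hu := hasSum_norm_coeffVec_sq fun i => hasSum_inner_conjBasis_smul (hU i)
  have hv := hasSum_norm_coeffVec_sq fun j => hasSum_inner_trigBasis_smul (hV j)
  simpa only [controlCost, norm_sq_eq_integral, div_eq_inv_mul, mul_one] using
    (hu.mul_left (m : ℝ)⁻¹).add (hv.mul_left (n : ℝ)⁻¹)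

theorem hasSum_toEuclideanLin_iff {a : ℕ → EuclideanSpace ℝ (Fin m)}
    {b : ℕ → EuclideanSpace ℝ (Fin n)} :
    (∀ x, HasSum (fun l => inner ℝ (b l) x • a l) (Matrix.toEuclideanLin H x)) ↔
      ∀ i j, HasSum (fun l => a l i * b l j) (H i j) := by
  refine ⟨fun h i j => ?_, fun h x => ?_⟩
  · have hentry := (h (EuclideanSpace.single j 1)).mapL (EuclideanSpace.proj i)
    simpa [EuclideanSpace.inner_single_right, mul_comm] using hentry
  · refine (EuclideanSpace.equiv (Fin m) ℝ).hasSum'.1 (Pi.hasSum.2 fun i => ?_)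
    have hrow := hasSum_sum fun j (_ : j ∈ Finset.univ) => (h i j).mul_right (x j)
    refine hrow.congr_fun fun l => ?_
    simp [PiLp.inner_apply, Finset.mul_sum, mul_comm, mul_left_comm]

theorem two_div_sqrt_mul_le {s t : ℝ} (hs : 0 ≤ s) (ht : 0 ≤ t) (a b : ℝ) :
    2 / √(s * t) * (a * b) ≤ a ^ 2 / s + b ^ 2 / t := by
  have h := two_mul_le_add_sq (a / √s) (b / √t)
  rw [div_pow, div_pow, Real.sq_sqrt hs, Real.sq_sqrt ht] at h
  rw [Real.sqrt_mul hs]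
  exact h.trans_eq' (by ring)

theorem le_controlCost {U : Fin m → L2} {V : Fin n → L2} (hU : ∀ i, U i ∈ admissible)
    (hV : ∀ j, V j ∈ admissible) (h : Realizes U V H) :
    2 * Real.pi / √((m : ℝ) * n) *
      ∑ k ∈ Finset.range n, freq k * (Matrix.toEuclideanLin H).singularValues k ≤
        controlCost U V := by
  set u := coeffVec ℝ conjBasis U
  set v := coeffVec ℝ trigBasis V
  have hu : Summable fun l => ‖u l‖ ^ 2 :=
    (hasSum_norm_coeffVec_sq fun i => hasSum_inner_conjBasis_smul (hU i)).summable
  have hv : Summable fun l => ‖v l‖ ^ 2 :=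
    (hasSum_norm_coeffVec_sq fun j => hasSum_inner_trigBasis_smul (hV j)).summable
  have huv : Summable fun l => ‖u l‖ * ‖v l‖ :=
    (hu.add hv).of_nonneg_of_le (fun l => by positivity) fun l => by
      nlinarith [two_mul_le_add_sq ‖u l‖ ‖v l‖, norm_nonneg (u l), norm_nonneg (v l)]
  have hT : ∀ x, HasSum (fun l => inner ℝ (v l) x • (Real.pi * freq l)⁻¹ • u l)
      (Matrix.toEuclideanLin H x) :=
    hasSum_toEuclideanLin_iff.2 fun i j => by
      simpa only [PiLp.smul_apply, smul_eq_mul, mul_assoc] using (realizes_iff hU hV).1 h i j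
  have hweight : ∀ l, freq l * (‖(Real.pi * freq l)⁻¹ • u l‖ * ‖v l‖) =
      Real.pi⁻¹ * (‖u l‖ * ‖v l‖) := fun l => by
    have hfreq := freq_pos l
    rw [norm_smul, Real.norm_of_nonneg (by positivity)]
    field_simp
  have hsingular := sum_weight_mul_singularValues_le (w := fun l => freq l)
    (Nat.mono_cast.comp monotone_freq) (freq_pos 0) hT
    (by simpa only [hweight] using huv.mul_left Real.pi⁻¹)
  simp only [hweight, tsum_mul_left, finrank_euclideanSpace_fin] at hsingular
  calc _ ≤ 2 * Real.pi / √((m : ℝ) * n) * (Real.pi⁻¹ * ∑' l, ‖u l‖ * ‖v l‖) := by gcongr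
    _ = ∑' l, 2 / √((m : ℝ) * n) * (‖u l‖ * ‖v l‖) := by
      rw [tsum_mul_left]
      field_simp
    _ ≤ controlCost U V :=
      hasSum_le (fun l => two_div_sqrt_mul_le m.cast_nonneg n.cast_nonneg _ _)
        (huv.mul_left _).hasSum (hasSum_controlCost hU hV)

/-- The equality case of `two_div_sqrt_mul_le`, with prescribed product. -/
theorem exists_mul_eq_sq_div_eq {s t ω : ℝ} (hs : 0 < s) (ht : 0 < t) (hω : 0 < ω) :
    ∃ α β : ℝ, α * β = ω ∧ α ^ 2 / s = ω / √(s * t) ∧ β ^ 2 / t = ω / √(s * t) := by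
  refine ⟨√(ω * √s / √t), √(ω * √t / √s), ?_, ?_, ?_⟩
  · rw [← Real.sqrt_mul (by positivity), Real.sqrt_eq_iff_mul_self_eq (by positivity) hω.le]
    field_simp
  · rw [Real.sq_sqrt (by positivity), Real.sqrt_mul hs.le]
    field_simp
    rw [Real.sq_sqrt hs.le]
  · rw [Real.sq_sqrt (by positivity), Real.sqrt_mul hs.le]
    field_simp
    rw [Real.sq_sqrt ht.le]

theorem exists_realizes_controlCost_eq (hm : 0 < m) (hn : 0 < n) (H : Matrix (Fin m) (Fin n) ℝ) :
    ∃ (U : Fin m → L2) (V : Fin n → L2),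
      (∀ i, U i ∈ Submodule.span ℝ (range trigBasis)) ∧
      (∀ j, V j ∈ Submodule.span ℝ (range trigBasis)) ∧ Realizes U V H ∧
      controlCost U V = 2 * Real.pi / √((m : ℝ) * n) *
        ∑ k ∈ Finset.range n, freq k * (Matrix.toEuclideanLin H).singularValues k := by
  set T := Matrix.toEuclideanLin H
  obtain ⟨p, q, hp, hq, hpq⟩ := exists_balanced_singular_decomposition T
  choose α β hαβ hα hβ using fun l => exists_mul_eq_sq_div_eq (Nat.cast_pos.2 hm)
    (Nat.cast_pos.2 hn) (mul_pos Real.pi_pos (freq_pos l))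
  have hαp : (Function.support fun l => α l • p l).Finite :=
    (finite_support_of_norm_sq_eq_singularValues T hp).subset
      (Function.support_smul_subset_right α p)
  have hβq : (Function.support fun l => β l • q l).Finite :=
    (finite_support_of_norm_sq_eq_singularValues T hq).subset
      (Function.support_smul_subset_right β q)
  obtain ⟨U, hU, hUc⟩ := exists_mem_span_coeffVec_eq orthonormal_conjBasis hαp
  obtain ⟨V, hV, hVc⟩ := exists_mem_span_coeffVec_eq orthonormal_trigBasis hβq
  have hU' := fun i => span_conjBasis_le (hU i)
  have hUa := fun i => mem_admissible_of_mem_span (hU' i)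
  have hVa := fun j => mem_admissible_of_mem_span (hV j)
  refine ⟨U, V, hU', hV, (realizes_iff hUa hVa).2 fun i j => ?_, ?_⟩
  · refine (hasSum_toEuclideanLin_iff.1 hpq i j).congr_fun fun l => ?_
    have hfreq := freq_pos l
    simp only [hUc, hVc, PiLp.smul_apply, smul_eq_mul, mul_mul_mul_comm (α l), hαβ]
    field_simp
  · refine (hasSum_controlCost hUa hVa).unique ?_
    rw [Finset.mul_sum]
    refine (hasSum_sum_of_ne_finset_zero fun l hl => ?_).congr_fun fun l => ?_
    · have hnl : n ≤ l := not_lt.1 (Finset.mem_range.not.1 hl)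
      rw [T.singularValues_of_finrank_le (finrank_euclideanSpace_fin.trans_le hnl), mul_zero,
        mul_zero]
    · rw [hUc, hVc, norm_smul, norm_smul, mul_pow, mul_pow, hp, hq, Real.norm_eq_abs,
        Real.norm_eq_abs, sq_abs, sq_abs, mul_div_right_comm, mul_div_right_comm, hα, hβ]
      ring

theorem ceil_succ_div_two (k : ℕ) : ⌈((k + 1 : ℕ) : ℝ) / 2⌉₊ = freq k := by
  have hlt : 2 * (k / 2) < k + 1 := by omega
  have hle : k + 1 ≤ 2 * (k / 2 + 1) := by omega
  rw [freq, Nat.ceil_eq_iff (Nat.succ_ne_zero _), Nat.succ_sub_one, lt_div_iff₀' two_pos,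
    div_le_iff₀' two_pos]
  exact ⟨by exact_mod_cast hlt, by exact_mod_cast hle⟩

theorem singularValues_toEuclideanLin_eq_zero (H : Matrix (Fin m) (Fin n) ℝ) {k : ℕ}
    (hk : min m n ≤ k) : (Matrix.toEuclideanLin H).singularValues k = 0 := by
  rw [LinearMap.singularValues_eq_zero_iff_le_finrank_range]
  refine (le_min ?_ ?_).trans hk
  · exact (Submodule.finrank_le _).trans_eq finrank_euclideanSpace_fin
  · exact (LinearMap.finrank_range_le _).trans_eq finrank_euclideanSpace_fin

theorem sum_ceil_mul_sigma (H : Matrix (Fin m) (Fin n) ℝ) :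
    ∑ k ∈ Finset.Icc 1 (min m n), (⌈(k : ℝ) / 2⌉₊ : ℝ) * sigma H k =
      ∑ k ∈ Finset.range n, freq k * (Matrix.toEuclideanLin H).singularValues k := by
  rw [← Finset.Ico_succ_right_eq_Icc, Finset.sum_Ico_eq_sum_range]
  refine Eq.trans (Finset.sum_congr rfl fun k _ => ?_) <|
    Finset.sum_subset (Finset.range_mono (min_le_right m n)) fun k _ hk => ?_
  · rw [add_comm 1 k, ceil_succ_div_two, sigma, Nat.add_sub_cancel]
  · rw [singularValues_toEuclideanLin_eq_zero H (not_lt.1 (Finset.mem_range.not.1 hk)), mul_zero]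

end Reduction

end BrockettHeisenberg

theorem corollary5p1 {m n : ℕ} (hm : 0 < m) (hn : 0 < n) (H : Matrix (Fin m) (Fin n) ℝ) :
    IsLeast (BrockettHeisenberg.costSet H)
      (2 * Real.pi / √((m : ℝ) * n) *
        ∑ k ∈ Finset.Icc 1 (min m n), (⌈(k : ℝ) / 2⌉₊ : ℝ) * BrockettHeisenberg.sigma H k) ∧
    ∃ (U : Fin m → BrockettHeisenberg.L2) (V : Fin n → BrockettHeisenberg.L2),
      (∀ i, U i ∈ Submodule.span ℝ (Set.range BrockettHeisenberg.trigBasis)) ∧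
      (∀ j, V j ∈ Submodule.span ℝ (Set.range BrockettHeisenberg.trigBasis)) ∧
      BrockettHeisenberg.Realizes U V H ∧
      BrockettHeisenberg.controlCost U V =
        2 * Real.pi / √((m : ℝ) * n) *
          ∑ k ∈ Finset.Icc 1 (min m n), (⌈(k : ℝ) / 2⌉₊ : ℝ) * BrockettHeisenberg.sigma H k := by
  rw [BrockettHeisenberg.sum_ceil_mul_sigma]
  obtain ⟨U, V, hU, hV, hUV, hcost⟩ := BrockettHeisenberg.exists_realizes_controlCost_eq hm hn H
  have hUa := fun i => BrockettHeisenberg.mem_admissible_of_mem_span (hU i)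
  have hVa := fun j => BrockettHeisenberg.mem_admissible_of_mem_span (hV j)
  refine ⟨⟨⟨U, V, hUa, hVa, hUV, hcost.symm⟩, ?_⟩, U, V, hU, hV, hUV, hcost⟩
  rintro _ ⟨U', V', hU', hV', hUV', rfl⟩
  exact BrockettHeisenberg.le_controlCost hU' hV' hUV'
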